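/- Let $n\ge 8$, $T\ge 1$, $L>0$, $D>0$. Let $\mathcal X\subset\mathbb R^n$ be a closed convex bounded set with $\operatorname{diam}(\mathcal X)\le D$, and let $\ell_1,\dots,\ell_T:\mathbb R^n\to\mathbb R$ be a fixed (non-random) sequence of convex $L$-smooth losses, in the sense that each $\ell_t$ is differentiable on $\mathbb R^n$ and $$\ell_t(x)-\ell_t(y)-\langle\nabla\ell_t(y),x-y\rangle\ \ge\ \tfrac1{2L}\|\nabla\ell_t(x)-\nabla\ell_t(y)\|^2\qquad\text{for all }x,y\in\mathbb R^n,$$ where $\|\cdot\|$ and $\langle\cdot,\cdot\rangle$ are Euclidean. Let $s_1,s_2,\dots$ be independent random vectors, each uniformly distributed on the unit sphere of $\mathbb R^n$. Put $\alpha=\tfrac{\sqrt2 D}{2}$ and $\mu=\tfrac{D}{n\sqrt T}$. Bandit gradient descent with AdaGrad-Norm learning rate starts from a deterministic point $x^1\in\mathcal X$ and for $t=1,2,\dots$ sets $$g_t=\frac{n}{2\mu}\bigl[\ell_t(x^t+\mu s_t)-\ell_t(x^t-\mu s_t)\bigr]s_t,\qquad x^{t+1}=\Pi_{\mathcal X}\Bigl[x^t-\frac{\alpha}{\sqrt{\sum_{i=1}^t\|g_i\|^2}}\,g_t\Bigr],$$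 with $x^{t+1}=x^t$ if $g_t=0$; here $\Pi_{\mathcal X}$ is the Euclidean projection onto $\mathcal X$. For $x\in\mathcal X$ let $\rho_T(x)=\sum_{t=1}^T\bigl(\ell_t(x^t)-\ell_t(x)\bigr)$ be the regret and $G_T(x)=\sum_{t=1}^T\|\nabla\ell_t(x)\|^2$. Then for every $x\in\mathcal X$ the random variable $\rho_T(x)$ is integrable and $$\mathbb E[\rho_T(x)]\ \le\ \max\bigl\{16LD^2n,\ 4D\sqrt{n\,G_T(x)}\bigr\}+5LD^2 .$$ -/

import Mathlib

open MeasureTheory ProbabilityTheory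
open scoped InnerProductSpace

namespace BanditOCO

noncomputable section

/-- A differentiable convex `L`-smooth function on the whole space, expressed by the inequality
`f x - f y - ⟪∇ f y, x - y⟫ ≥ (1 / (2 L)) ‖∇ f x - ∇ f y‖²` for all `x, y` (for `0 < L` this
inequality contains both convexity and `L`-smoothness). -/
structure IsSmoothConvex {n : ℕ} (L : ℝ) (f : EuclideanSpace ℝ (Fin n) → ℝ) : Prop where
  differentiable : Differentiable ℝ f
  lower_bound : ∀ x y : EuclideanSpace ℝ (Fin n),
    1 / (2 * L) * ‖gradient f x - gradient f y‖ ^ 2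
      ≤ f x - f y - ⟪gradient f y, x - y⟫_ℝ

open Classical in
/-- Euclidean projection of `y` onto `X`: a point of `X` closest to `y`. It exists and is unique
when `X` is nonempty, closed and convex; otherwise, if no closest point exists, the value is `y`. -/
def proj {n : ℕ} (X : Set (EuclideanSpace ℝ (Fin n))) (y : EuclideanSpace ℝ (Fin n)) :
    EuclideanSpace ℝ (Fin n) :=
  if h : ∃ p ∈ X, ∀ q ∈ X, dist y p ≤ dist y q then h.choose else y

/-- The uniform probability law on the unit sphere of `ℝⁿ`, as a measure on `ℝⁿ`: the normalized
surface measure of the sphere. -/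
def uniformSphere (n : ℕ) : Measure (EuclideanSpace ℝ (Fin n)) :=
  (((volume : Measure (EuclideanSpace ℝ (Fin n))).toSphere Set.univ)⁻¹ •
    (volume : Measure (EuclideanSpace ℝ (Fin n))).toSphere).map Subtype.val

/-- Two-point gradient estimator `(n / (2 μ)) (f (x + μ s) - f (x - μ s)) s`. -/
def gradEstimator {n : ℕ} (μ : ℝ) (f : EuclideanSpace ℝ (Fin n) → ℝ)
    (x s : EuclideanSpace ℝ (Fin n)) : EuclideanSpace ℝ (Fin n) :=
  ((n : ℝ) / (2 * μ) * (f (x + μ • s) - f (x - μ • s))) • s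

open Classical in
/-- State of bandit gradient descent with AdaGrad-Norm learning rate before round `t` (rounds are
numbered `0, 1, 2, …`): the current point `x^t` and the accumulated sum
`∑_{i < t} ‖g_i‖²`. In round `t` the estimator `g_t` is built from the loss `ℓ t` and the direction
`s t`, the sum is updated to include `‖g_t‖²`, and the point is updated with learning rate
`α / √(∑_{i ≤ t} ‖g_i‖²)`; the update is skipped when `g_t = 0`. -/
def bgdState {n : ℕ} (X : Set (EuclideanSpace ℝ (Fin n))) (α μ : ℝ)
    (ℓ : ℕ → EuclideanSpace ℝ (Fin n) → ℝ) (x₁ : EuclideanSpace ℝ (Fin n))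
    (s : ℕ → EuclideanSpace ℝ (Fin n)) : ℕ → EuclideanSpace ℝ (Fin n) × ℝ
  | 0 => (x₁, 0)
  | t + 1 =>
    let x := (bgdState X α μ ℓ x₁ s t).1
    let g := gradEstimator μ (ℓ t) x (s t)
    let v := (bgdState X α μ ℓ x₁ s t).2 + ‖g‖ ^ 2
    (if g = 0 then x else proj X (x - (α / √v) • g), v)

/-- The point played in round `t`. -/
def bgdIterate {n : ℕ} (X : Set (EuclideanSpace ℝ (Fin n))) (α μ : ℝ)
    (ℓ : ℕ → EuclideanSpace ℝ (Fin n) → ℝ) (x₁ : EuclideanSpace ℝ (Fin n))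
    (s : ℕ → EuclideanSpace ℝ (Fin n)) (t : ℕ) : EuclideanSpace ℝ (Fin n) :=
  (bgdState X α μ ℓ x₁ s t).1

/-- The regret `∑_{t < T} (ℓ_t(x^t) - ℓ_t(x))` of the points `p` against the comparator `x`. -/
def regret {n : ℕ} (ℓ : ℕ → EuclideanSpace ℝ (Fin n) → ℝ) (p : ℕ → EuclideanSpace ℝ (Fin n))
    (T : ℕ) (x : EuclideanSpace ℝ (Fin n)) : ℝ :=
  ∑ t ∈ Finset.range T, (ℓ t (p t) - ℓ t x)

/-- The cumulative non-stationarity `G_T(x) = ∑_{t < T} ‖∇ ℓ_t(x)‖²`. -/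
def cumNonstationarity {n : ℕ} (ℓ : ℕ → EuclideanSpace ℝ (Fin n) → ℝ) (T : ℕ)
    (x : EuclideanSpace ℝ (Fin n)) : ℝ :=
  ∑ t ∈ Finset.range T, ‖gradient (ℓ t) x‖ ^ 2

end

end BanditOCO

/-! The difficulty is to bound the bias of `gradEstimator` against a comparator while keeping a gain
that can pay for its variance. Let `w = x - y`. Reflecting the direction `s` in the line `ℝ ∙ w`
keeps its `w`-component and negates the rest, so the four evaluation points for `s` and its
reflection regroup into two segments parallel to `w`. Integrating a gradient inequality along these,
the first-order error terms cancel and the sphere average gives `f x - f y + ‖∇f x - ∇f y‖² / (4L) -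
(5/2)Lμ²` as a lower bound (`integral_inner_gradEstimator_ge`).

The AdaGrad-Norm potential argument bounds the linearized regret pathwise by `√2 D √V`, where `V`
sums the squared estimators. By Jensen and the second-moment bound, its mean is at most `√2 D √(4nS
+ 4nG + L²D²/8)`, with `S` the expected sum of squared gradient differences and `G = G_T(x)`. The
gain `S / (4L)` on the left absorbs the dependence on `S` (`regret_bound_of_recursive_bound`). -/

namespace BanditOCO

/-! ### Deterministic inequalities for smooth convex functions. -/

namespace IsSmoothConvex

variable {n : ℕ} {L : ℝ} {f : EuclideanSpace ℝ (Fin n) → ℝ}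

theorem add_inner_le (hf : IsSmoothConvex L f) (hL : 0 < L) (x y : EuclideanSpace ℝ (Fin n)) :
    f y + ⟪gradient f y, x - y⟫_ℝ ≤ f x := by
  have h := hf.lower_bound x y
  have h0 : 0 ≤ 1 / (2 * L) * ‖gradient f x - gradient f y‖ ^ 2 := by positivity
  linarith

/-- Adding the defining inequality to its copy with `x` and `y` swapped gives cocoercivity;
Cauchy–Schwarz then cancels one factor. -/
theorem norm_gradient_sub_le (hf : IsSmoothConvex L f) (hL : 0 < L)
    (x y : EuclideanSpace ℝ (Fin n)) : ‖gradient f x - gradient f y‖ ≤ L * ‖x - y‖ := by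
  have h1 := hf.lower_bound x y
  have h2 := hf.lower_bound y x
  rw [norm_sub_rev (gradient f y), ← neg_sub x y, inner_neg_right] at h2
  have h3 := real_inner_le_norm (gradient f x - gradient f y) (x - y)
  rw [inner_sub_left] at h3
  have h4 : 2 * (1 / (2 * L) * ‖gradient f x - gradient f y‖ ^ 2) ≤
      ‖gradient f x - gradient f y‖ * ‖x - y‖ := by linarith
  have h5 : ‖gradient f x - gradient f y‖ ^ 2 ≤
      L * (‖gradient f x - gradient f y‖ * ‖x - y‖) := by
    calc _ = L * (2 * (1 / (2 * L) * ‖gradient f x - gradient f y‖ ^ 2)) := by field_simp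
      _ ≤ _ := by gcongr
  rcases (norm_nonneg (gradient f x - gradient f y)).eq_or_lt with h | h
  · rw [← h]; positivity
  · nlinarith

theorem le_add_inner_add (hf : IsSmoothConvex L f) (hL : 0 < L)
    (x y : EuclideanSpace ℝ (Fin n)) :
    f x ≤ f y + ⟪gradient f y, x - y⟫_ℝ + L / 2 * ‖x - y‖ ^ 2 := by
  have h2 := hf.lower_bound y x
  rw [norm_sub_rev (gradient f y), ← neg_sub x y, inner_neg_right] at h2
  have h3 := real_inner_le_norm (gradient f x - gradient f y) (x - y)
  rw [inner_sub_left] at h3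
  have h4 : ‖gradient f x - gradient f y‖ * ‖x - y‖ ≤
      1 / (2 * L) * ‖gradient f x - gradient f y‖ ^ 2 + L / 2 * ‖x - y‖ ^ 2 := by
    have : 0 ≤ 1 / (2 * L) * (‖gradient f x - gradient f y‖ - L * ‖x - y‖) ^ 2 := by positivity
    have h5 : 1 / (2 * L) * (‖gradient f x - gradient f y‖ - L * ‖x - y‖) ^ 2 =
      1 / (2 * L) * ‖gradient f x - gradient f y‖ ^ 2 + L / 2 * ‖x - y‖ ^ 2
        - ‖gradient f x - gradient f y‖ * ‖x - y‖ := by field_simp; ring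
    linarith
  linarith

theorem continuous_gradient (hf : IsSmoothConvex L f) (hL : 0 < L) :
    Continuous (gradient f) := by
  refine (LipschitzWith.of_dist_le_mul (K := ⟨L, hL.le⟩) fun x y => ?_).continuous
  rw [dist_eq_norm, dist_eq_norm]
  exact hf.norm_gradient_sub_le hL x y

/-- By convexity both one-sided Taylor remainders lie in `[0, Lμ²/2]`, so their difference is no
larger than either bound. -/
theorem abs_sub_sub_inner_le (hf : IsSmoothConvex L f) (hL : 0 < L) (μ : ℝ)
    (x s : EuclideanSpace ℝ (Fin n)) (hs : ‖s‖ = 1) :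
    |f (x + μ • s) - f (x - μ • s) - 2 * μ * ⟪gradient f x, s⟫_ℝ| ≤ L / 2 * μ ^ 2 := by
  have h1 := hf.add_inner_le hL (x + μ • s) x
  have h2 := hf.le_add_inner_add hL (x + μ • s) x
  have h3 := hf.add_inner_le hL (x - μ • s) x
  have h4 := hf.le_add_inner_add hL (x - μ • s) x
  simp only [add_sub_cancel_left, sub_sub_cancel_left, inner_neg_right, real_inner_smul_right,
    norm_neg, norm_smul, hs, mul_one, Real.norm_eq_abs, sq_abs] at h1 h2 h3 h4
  rw [abs_le]
  constructor <;> linarith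

theorem norm_gradEstimator_sq_le (hf : IsSmoothConvex L f) (hL : 0 < L) {μ : ℝ} (hμ : 0 < μ)
    (x s : EuclideanSpace ℝ (Fin n)) (hs : ‖s‖ = 1) :
    ‖gradEstimator μ f x s‖ ^ 2 ≤
      2 * n ^ 2 * ⟪gradient f x, s⟫_ℝ ^ 2 + n ^ 2 * L ^ 2 * μ ^ 2 / 8 := by
  have h := hf.abs_sub_sub_inner_le hL μ x s hs
  rw [gradEstimator, norm_smul, hs, mul_one, Real.norm_eq_abs, sq_abs]
  set d := f (x + μ • s) - f (x - μ • s)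
  set c := ⟪gradient f x, s⟫_ℝ
  have h1 : (d - 2 * μ * c) ^ 2 ≤ (L / 2 * μ ^ 2) ^ 2 := sq_le_sq.2 (h.trans (le_abs_self _))
  have h2 : d ^ 2 ≤ 2 * (2 * μ * c) ^ 2 + 2 * (L / 2 * μ ^ 2) ^ 2 := by
    nlinarith [sq_nonneg (d - 4 * μ * c)]
  calc (n / (2 * μ) * d) ^ 2 = (n / (2 * μ)) ^ 2 * d ^ 2 := by ring
    _ ≤ (n / (2 * μ)) ^ 2 * (2 * (2 * μ * c) ^ 2 + 2 * (L / 2 * μ ^ 2) ^ 2) := by gcongr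
    _ = _ := by field_simp; ring

/-- The defining inequality is applied at the translates `x + u`, `y + u` and carried back to `x`,
`y`. Returning the function values costs `Lμ²/2`, returning the gradient difference costs `2Lμ²`.
The remaining error is linear in `u`, hence removable by symmetry. -/
theorem inner_gradient_lower_bound (hf : IsSmoothConvex L f) (hL : 0 < L) {μ : ℝ}
    (x y u : EuclideanSpace ℝ (Fin n)) (hu : ‖u‖ ≤ μ) :
    f x - f y + ‖gradient f x - gradient f y‖ ^ 2 / (4 * L) - 5 / 2 * L * μ ^ 2 +
      ⟪gradient f x - gradient f y, u⟫_ℝ ≤ ⟪gradient f (x + u), x - y⟫_ℝ := by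
  have h1 := hf.lower_bound (y + u) (x + u)
  have h2 := hf.add_inner_le hL (x + u) x
  have h3 := hf.le_add_inner_add hL (y + u) y
  have h4 := hf.norm_gradient_sub_le hL (x + u) x
  have h5 := hf.norm_gradient_sub_le hL (y + u) y
  rw [add_sub_add_right_eq_sub, ← neg_sub x y, inner_neg_right] at h1
  simp only [add_sub_cancel_left] at h2 h3 h4 h5
  rw [inner_sub_left]
  have hμ : 0 ≤ μ := (norm_nonneg u).trans hu
  have h6 : ‖gradient f x - gradient f y‖ ≤
      ‖gradient f (y + u) - gradient f (x + u)‖ + 2 * L * μ := by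
    calc ‖gradient f x - gradient f y‖ = ‖(gradient f (y + u) - gradient f y) -
          (gradient f (y + u) - gradient f (x + u)) - (gradient f (x + u) - gradient f x)‖ := by
          congr 1; abel
      _ ≤ ‖gradient f (y + u) - gradient f y‖ + ‖gradient f (y + u) - gradient f (x + u)‖ +
          ‖gradient f (x + u) - gradient f x‖ :=
          (norm_sub_le _ _).trans (by gcongr; exact norm_sub_le _ _)
      _ ≤ _ := by nlinarith
  set a := ‖gradient f x - gradient f y‖
  set b := ‖gradient f (y + u) - gradient f (x + u)‖
  have h7 : a ^ 2 ≤ 2 * b ^ 2 + 8 * (L * μ) ^ 2 := by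
    have : a ^ 2 ≤ (b + 2 * L * μ) ^ 2 := by
      gcongr
    nlinarith [sq_nonneg (b - 2 * L * μ)]
  have h8 : a ^ 2 / (4 * L) ≤ 1 / (2 * L) * b ^ 2 + 2 * L * μ ^ 2 := by
    rw [div_le_iff₀ (by positivity)]
    calc a ^ 2 ≤ _ := h7
      _ = _ := by field_simp; ring
  have h9 : L / 2 * ‖u‖ ^ 2 ≤ L / 2 * μ ^ 2 := by gcongr
  linarith

theorem segment_lower_bound (hf : IsSmoothConvex L f) (hL : 0 < L) {μ τ : ℝ} (hτ : 0 ≤ τ)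
    (x y v : EuclideanSpace ℝ (Fin n))
    (hv : ∀ θ ∈ Set.Icc (-τ) τ, ‖v + θ • (x - y)‖ ≤ μ) :
    2 * τ * (f x - f y + ‖gradient f x - gradient f y‖ ^ 2 / (4 * L) - 5 / 2 * L * μ ^ 2 +
      ⟪gradient f x - gradient f y, v⟫_ℝ) ≤
      f (x + (v + τ • (x - y))) - f (x + (v - τ • (x - y))) := by
  set A := f x - f y + ‖gradient f x - gradient f y‖ ^ 2 / (4 * L) - 5 / 2 * L * μ ^ 2 +
      ⟪gradient f x - gradient f y, v⟫_ℝ with hA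
  set B := ⟪gradient f x - gradient f y, x - y⟫_ℝ with hB
  -- Integration in disguise: subtracting the primitive of the lower bound `A + B * θ` leaves a
  -- monotone function. The even term `B * (θ ^ 2 / 2)` agrees at `τ` and `-τ`.
  have hd : ∀ θ : ℝ, HasDerivAt
      (fun θ : ℝ => f (x + (v + θ • (x - y))) - (A * θ + B * (θ ^ 2 / 2)))
      (⟪gradient f (x + (v + θ • (x - y))), x - y⟫_ℝ - (A + B * θ)) θ := by
    intro θ
    have h1 : HasDerivAt (fun θ : ℝ => x + (v + θ • (x - y))) (x - y) θ := by
      simpa using (((hasDerivAt_id θ).smul_const (x - y)).const_add v).const_add x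
    have h2 := ((hf.differentiable (x + (v + θ • (x - y)))).hasGradientAt.hasFDerivAt).comp_hasDerivAt
      θ h1
    have h3 : HasDerivAt (fun θ : ℝ => A * θ + B * (θ ^ 2 / 2)) (A + B * θ) θ := by
      have := ((hasDerivAt_id θ).const_mul A).add
        ((((hasDerivAt_id θ).pow 2).div_const 2).const_mul B)
      refine (this.congr_deriv ?_)
      simp
    exact h2.sub h3
  have hm : MonotoneOn (fun θ : ℝ => f (x + (v + θ • (x - y))) - (A * θ + B * (θ ^ 2 / 2)))
      (Set.Icc (-τ) τ) := by
    refine monotoneOn_of_deriv_nonneg (convex_Icc _ _)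
      (fun θ _ => (hd θ).continuousAt.continuousWithinAt)
      (fun θ _ => (hd θ).differentiableAt.differentiableWithinAt) fun θ hθ => ?_
    rw [(hd θ).deriv]
    have := hf.inner_gradient_lower_bound hL x y _ (hv θ (interior_subset hθ))
    rw [inner_add_right, real_inner_smul_right, ← hB] at this
    linarith
  have := hm (Set.left_mem_Icc.2 (by linarith)) (Set.right_mem_Icc.2 (by linarith))
    (by linarith : -τ ≤ τ)
  simp only [neg_smul, ← sub_eq_add_neg] at this
  linarith

theorem mul_segment_lower_bound (hf : IsSmoothConvex L f) (hL : 0 < L) {μ τ : ℝ}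
    (x y v : EuclideanSpace ℝ (Fin n))
    (hv : ∀ θ ∈ Set.Icc (-|τ|) |τ|, ‖v + θ • (x - y)‖ ≤ μ) :
    2 * τ ^ 2 * (f x - f y + ‖gradient f x - gradient f y‖ ^ 2 / (4 * L) - 5 / 2 * L * μ ^ 2 +
      ⟪gradient f x - gradient f y, v⟫_ℝ) ≤
      τ * (f (x + (v + τ • (x - y))) - f (x + (v - τ • (x - y)))) := by
  have h := mul_le_mul_of_nonneg_left (hf.segment_lower_bound hL (abs_nonneg τ) x y v hv)
    (abs_nonneg τ)
  rcases abs_cases τ with ⟨h1, -⟩ | ⟨h1, -⟩ <;> rw [h1] at h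
  · linarith
  · simp only [neg_smul, sub_neg_eq_add, ← sub_eq_add_neg] at h
    linarith

end IsSmoothConvex

/-! ### Pairing a direction with its reflection. -/

theorem norm_add_smul_le_of_inner_eq_zero {n : ℕ} {z w : EuclideanSpace ℝ (Fin n)}
    (h : ⟪z, w⟫_ℝ = 0) {θ τ : ℝ} (hθ : |θ| ≤ |τ|) : ‖z + θ • w‖ ≤ ‖z + τ • w‖ := by
  have e : ∀ r : ℝ, ‖z + r • w‖ ^ 2 = ‖z‖ ^ 2 + r ^ 2 * ‖w‖ ^ 2 := by
    intro r
    rw [norm_add_sq_real, real_inner_smul_right, h, norm_smul, mul_pow, Real.norm_eq_abs, sq_abs]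
    ring
  rw [← sq_le_sq₀ (norm_nonneg _) (norm_nonneg _), e, e]
  have := sq_le_sq.2 hθ
  gcongr

theorem IsSmoothConvex.inner_gradEstimator_add_reflection {n : ℕ} {L : ℝ}
    {f : EuclideanSpace ℝ (Fin n) → ℝ} (hf : IsSmoothConvex L f) (hL : 0 < L) {μ : ℝ}
    (hμ : 0 < μ) (x y s : EuclideanSpace ℝ (Fin n)) (hs : ‖s‖ = 1) (hxy : x ≠ y) :
    2 * n * (f x - f y + ‖gradient f x - gradient f y‖ ^ 2 / (4 * L) - 5 / 2 * L * μ ^ 2) *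
      (⟪s, x - y⟫_ℝ ^ 2 / ‖x - y‖ ^ 2) ≤
      ⟪gradEstimator μ f x s, x - y⟫_ℝ +
        ⟪gradEstimator μ f x ((ℝ ∙ (x - y)).reflection s), x - y⟫_ℝ := by
  set w := x - y with hw
  have hw0 : 0 < ‖w‖ := norm_pos_iff.2 (sub_ne_zero.2 hxy)
  set K := f x - f y + ‖gradient f x - gradient f y‖ ^ 2 / (4 * L) - 5 / 2 * L * μ ^ 2 with hK
  set c := ⟪s, w⟫_ℝ with hc
  -- Orthogonal splitting: `μ • s = μ • z + τ • w`, and the reflection of `s`, scaled by `μ`, is `τ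
  -- • w - μ • z`. The segments used are centred at `x + μ • z` and `x - μ • z`.
  set z := s - (c / ‖w‖ ^ 2) • w with hz
  set τ := μ * (c / ‖w‖ ^ 2) with hτ
  have hzw : ⟪μ • z, w⟫_ℝ = 0 := by
    rw [real_inner_smul_left, hz, inner_sub_left, real_inner_smul_left, real_inner_self_eq_norm_sq,
      ← hc]
    field_simp
    ring
  have hzw' : ⟪-(μ • z), w⟫_ℝ = 0 := by rw [inner_neg_left, hzw, neg_zero]
  have hμs : μ • z + τ • w = μ • s := by
    rw [hz, hτ, smul_sub, smul_smul, sub_add_cancel]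
  have hμs' : -(μ • z) + (-τ) • w = -(μ • s) := by rw [← hμs, neg_smul, neg_add]
  have hnorm : ‖μ • s‖ = μ := by rw [norm_smul, hs, mul_one, Real.norm_of_nonneg hμ.le]
  have hr : (ℝ ∙ w).reflection s = (c / ‖w‖ ^ 2) • w - z := by
    rw [Submodule.reflection_singleton_apply, real_inner_comm, ← hc, hz, two_smul]
    simp only [RCLike.ofReal_real_eq_id, id]
    abel
  have hμr : μ • (ℝ ∙ w).reflection s = τ • w - μ • z := by rw [hr, smul_sub, smul_smul]
  have hrw : ⟪(ℝ ∙ w).reflection s, w⟫_ℝ = c := by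
    rw [hr, inner_sub_left, real_inner_smul_left, real_inner_self_eq_norm_sq]
    rw [real_inner_smul_left] at hzw
    rw [(mul_eq_zero.1 hzw).resolve_left hμ.ne']
    field_simp
    ring
  have h1 := hf.mul_segment_lower_bound hL (μ := μ) (τ := τ) x y (μ • z) (fun θ hθ => by
    rw [← hw]
    exact (norm_add_smul_le_of_inner_eq_zero hzw (abs_le.2 hθ)).trans (by rw [hμs, hnorm]))
  have h2 := hf.mul_segment_lower_bound hL (μ := μ) (τ := τ) x y (-(μ • z)) (fun θ hθ => by
    rw [← hw]
    refine (norm_add_smul_le_of_inner_eq_zero hzw' (τ := -τ) (abs_le.2 ?_)).trans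
      (by rw [hμs', norm_neg, hnorm])
    rwa [abs_neg])
  rw [← hw, ← hK, inner_neg_right] at h2
  rw [← hw, ← hK] at h1
  rw [gradEstimator, gradEstimator, real_inner_smul_left, real_inner_smul_left, hrw, ← hc, hμr]
  have e1 : x + (μ • z + τ • w) = x + μ • s := by rw [hμs]
  have e2 : x + (-(μ • z) - τ • w) = x - μ • s := by rw [← hμs]; abel
  have e3 : x + (μ • z - τ • w) = x - (τ • w - μ • z) := by abel
  have e4 : x + (-(μ • z) + τ • w) = x + (τ • w - μ • z) := by abel
  rw [e1, e3] at h1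
  rw [e2, e4] at h2
  -- The inner products with `μ • z` and `-(μ • z)` cancel in the sum.
  have h3 : 4 * τ ^ 2 * K ≤ τ * (f (x + μ • s) - f (x - (τ • w - μ • z))) +
      τ * (f (x + (τ • w - μ • z)) - f (x - μ • s)) := by linarith
  -- This factor turns `τ` into `n * c / (2 * μ)`, the weight in the estimator's inner product with
  -- `w`.
  have h4 := mul_le_mul_of_nonneg_left h3
    (by positivity : 0 ≤ (n : ℝ) * ‖w‖ ^ 2 / (2 * μ ^ 2))
  refine (le_of_eq ?_).trans (h4.trans (le_of_eq ?_))
  · rw [hτ]; field_simp; ring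
  · rw [hτ]; field_simp; ring

end BanditOCO

/-! ### The uniform law on the sphere. -/

namespace BanditOCO

section Sphere

variable {n : ℕ}

theorem isProbabilityMeasure_uniformSphere (hn : 0 < n) :
    IsProbabilityMeasure (uniformSphere n) := by
  have : Nonempty (Fin n) := ⟨⟨0, hn⟩⟩
  have h0 : (volume : Measure (EuclideanSpace ℝ (Fin n))).toSphere Set.univ ≠ 0 :=
    Measure.measure_univ_ne_zero.2 (Measure.toSphere_ne_zero _)
  have : IsProbabilityMeasure (((volume : Measure (EuclideanSpace ℝ (Fin n))).toSphere
      Set.univ)⁻¹ • (volume : Measure (EuclideanSpace ℝ (Fin n))).toSphere) :=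
    ⟨by simpa using ENNReal.inv_mul_cancel h0 (measure_ne_top _ _)⟩
  exact Measure.isProbabilityMeasure_map measurable_subtype_coe.aemeasurable

theorem ae_uniformSphere_norm_eq_one : ∀ᵐ s ∂uniformSphere n, ‖s‖ = 1 := by
  rw [uniformSphere, ae_map_iff measurable_subtype_coe.aemeasurable
    (isClosed_eq continuous_norm continuous_const).measurableSet]
  exact Filter.Eventually.of_forall fun s => norm_eq_of_mem_sphere s

open scoped Pointwise in
-- Surface measure is defined through the volume of the cone over a set; a linear isometry commutes
-- with forming cones and preserves volume.
theorem map_uniformSphere_linearIsometryEquiv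
    (e : EuclideanSpace ℝ (Fin n) ≃ₗᵢ[ℝ] EuclideanSpace ℝ (Fin n)) :
    (uniformSphere n).map e = uniformSphere n := by
  ext A hA
  have he : Measurable e := e.continuous.measurable
  rw [Measure.map_apply he hA, uniformSphere, Measure.map_apply measurable_subtype_coe (he hA),
    Measure.map_apply measurable_subtype_coe hA, Measure.smul_apply, Measure.smul_apply,
    Measure.toSphere_apply' _ (measurable_subtype_coe (he hA)),
    Measure.toSphere_apply' _ (measurable_subtype_coe hA)]
  congr 2
  have hset : Set.Ioo (0 : ℝ) 1 • (Subtype.val '' ((Subtype.val : Metric.sphere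
      (0 : EuclideanSpace ℝ (Fin n)) 1 → _) ⁻¹' (e ⁻¹' A))) =
      e ⁻¹' (Set.Ioo (0 : ℝ) 1 • (Subtype.val '' ((Subtype.val : Metric.sphere
      (0 : EuclideanSpace ℝ (Fin n)) 1 → _) ⁻¹' A))) := by
    ext v
    simp only [Set.mem_smul, Set.mem_image, Set.mem_preimage, Subtype.exists, mem_sphere_zero_iff_norm,
      exists_and_left, exists_prop, exists_eq_right_right]
    constructor
    · rintro ⟨r, hr, u, ⟨hu, hu1⟩, rfl⟩
      exact ⟨r, hr, e u, ⟨hu, by rwa [e.norm_map]⟩, by simp⟩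
    · rintro ⟨r, hr, u, ⟨hu, hu1⟩, h⟩
      refine ⟨r, hr, e.symm u, ⟨by simpa using hu, by rwa [e.symm.norm_map]⟩, ?_⟩
      rw [← map_smul, h, e.symm_apply_apply]
  rw [hset]
  exact (e.measurePreserving.measure_preimage_emb e.toHomeomorph.measurableEmbedding _)

theorem integrable_uniformSphere_of_continuous (hn : 0 < n) {F : Type*} [NormedAddCommGroup F]
    {g : EuclideanSpace ℝ (Fin n) → F} (hg : Continuous g) :
    Integrable g (uniformSphere n) := by
  have := isProbabilityMeasure_uniformSphere hn
  obtain ⟨C, hC⟩ := (isCompact_sphere (0 : EuclideanSpace ℝ (Fin n)) 1).exists_bound_of_continuousOn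
    hg.continuousOn
  refine Integrable.of_bound (C := C) hg.aestronglyMeasurable ?_
  filter_upwards [ae_uniformSphere_norm_eq_one] with s hs
  exact hC s (by simpa using hs)

theorem integral_uniformSphere_comp (e : EuclideanSpace ℝ (Fin n) ≃ₗᵢ[ℝ] EuclideanSpace ℝ (Fin n))
    (g : EuclideanSpace ℝ (Fin n) → ℝ) :
    ∫ s, g (e s) ∂uniformSphere n = ∫ s, g s ∂uniformSphere n := by
  conv_rhs => rw [← map_uniformSphere_linearIsometryEquiv e]
  exact (e.toHomeomorph.measurableEmbedding.integral_map g).symm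

theorem integral_uniformSphere_inner_sq_eq {v w : EuclideanSpace ℝ (Fin n)} (h : ‖v‖ = ‖w‖) :
    ∫ s, ⟪s, v⟫_ℝ ^ 2 ∂uniformSphere n = ∫ s, ⟪s, w⟫_ℝ ^ 2 ∂uniformSphere n := by
  rw [← integral_uniformSphere_comp ((ℝ ∙ (v - w))ᗮ.reflection) (fun s => ⟪s, w⟫_ℝ ^ 2)]
  congr with s
  conv_lhs => rw [← LinearIsometryEquiv.inner_map_map ((ℝ ∙ (v - w))ᗮ.reflection),
    Submodule.reflection_sub h]

/-- By reflection invariance the integral depends only on `‖w‖`, so it equals its average over the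
`n` scaled basis vectors, whose squares sum to `‖w‖ ^ 2` on the sphere. -/
theorem integral_uniformSphere_inner_sq (hn : 0 < n) (w : EuclideanSpace ℝ (Fin n)) :
    ∫ s, ⟪s, w⟫_ℝ ^ 2 ∂uniformSphere n = ‖w‖ ^ 2 / n := by
  have := isProbabilityMeasure_uniformSphere hn
  have hn' : (n : ℝ) ≠ 0 := by positivity
  have h1 : ∀ i : Fin n, ∫ s, ⟪s, ‖w‖ • EuclideanSpace.single i (1 : ℝ)⟫_ℝ ^ 2 ∂uniformSphere n =
      ∫ s, ⟪s, w⟫_ℝ ^ 2 ∂uniformSphere n := fun i =>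
    integral_uniformSphere_inner_sq_eq (by simp [norm_smul])
  have h2 : ∑ i : Fin n, ∫ s, ⟪s, ‖w‖ • EuclideanSpace.single i (1 : ℝ)⟫_ℝ ^ 2 ∂uniformSphere n =
      ‖w‖ ^ 2 := by
    rw [← integral_finsetSum _ fun i _ => integrable_uniformSphere_of_continuous hn (by fun_prop)]
    calc _ = ∫ s, ‖w‖ ^ 2 ∂uniformSphere n := by
          refine integral_congr_ae ?_
          filter_upwards [ae_uniformSphere_norm_eq_one] with s hs
          have : ∑ i, s i ^ 2 = 1 := by
            rw [← EuclideanSpace.real_norm_sq_eq, hs, one_pow]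
          simp [real_inner_smul_right, mul_pow, EuclideanSpace.inner_single_right, ← Finset.mul_sum,
            this]
      _ = _ := by simp
  rw [Finset.sum_congr rfl fun i _ => h1 i] at h2
  simp only [Finset.sum_const, Finset.card_univ, Fintype.card_fin, nsmul_eq_mul] at h2
  rw [eq_div_iff hn', mul_comm, h2]

end Sphere

/-! ### First and second moments of the estimator at a fixed point. -/

namespace IsSmoothConvex

variable {n : ℕ} {L : ℝ} {f : EuclideanSpace ℝ (Fin n) → ℝ}

theorem continuous (hf : IsSmoothConvex L f) : Continuous f := hf.differentiable.continuous

theorem continuous_gradEstimator (hf : IsSmoothConvex L f) (μ : ℝ) :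
    Continuous fun p : EuclideanSpace ℝ (Fin n) × EuclideanSpace ℝ (Fin n) =>
      gradEstimator μ f p.1 p.2 := by
  have := hf.continuous
  unfold gradEstimator
  fun_prop

theorem integral_inner_gradEstimator_ge (hf : IsSmoothConvex L f) (hL : 0 < L) {μ : ℝ}
    (hμ : 0 < μ) (hn : 0 < n) (x y : EuclideanSpace ℝ (Fin n)) :
    f x - f y + ‖gradient f x - gradient f y‖ ^ 2 / (4 * L) - 5 / 2 * L * μ ^ 2 ≤
      ∫ s, ⟪gradEstimator μ f x s, x - y⟫_ℝ ∂uniformSphere n := by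
  rcases eq_or_ne x y with rfl | hxy
  · simp
    positivity
  have hc : Continuous fun s => ⟪gradEstimator μ f x s, x - y⟫_ℝ := by
    have := (hf.continuous_gradEstimator μ).comp (Continuous.prodMk_right x)
    exact Continuous.inner this continuous_const
  have hn' : (n : ℝ) ≠ 0 := by positivity
  have hw0 : 0 < ‖x - y‖ := norm_pos_iff.2 (sub_ne_zero.2 hxy)
  have hr : Continuous (ℝ ∙ (x - y)).reflection := LinearIsometryEquiv.continuous _
  have hc' : Continuous fun s => ⟪gradEstimator μ f x ((ℝ ∙ (x - y)).reflection s), x - y⟫_ℝ :=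
    hc.comp hr
  have h : ∫ s, 2 * n * (f x - f y + ‖gradient f x - gradient f y‖ ^ 2 / (4 * L)
      - 5 / 2 * L * μ ^ 2) * (⟪s, x - y⟫_ℝ ^ 2 / ‖x - y‖ ^ 2) ∂uniformSphere n ≤
      ∫ s, (⟪gradEstimator μ f x s, x - y⟫_ℝ +
        ⟪gradEstimator μ f x ((ℝ ∙ (x - y)).reflection s), x - y⟫_ℝ) ∂uniformSphere n := by
    refine integral_mono_ae (integrable_uniformSphere_of_continuous hn (by fun_prop))
      (integrable_uniformSphere_of_continuous hn (hc.add hc')) ?_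
    filter_upwards [ae_uniformSphere_norm_eq_one] with s hs
    exact hf.inner_gradEstimator_add_reflection hL hμ x y s hs hxy
  rw [integral_add (integrable_uniformSphere_of_continuous hn hc)
    (integrable_uniformSphere_of_continuous hn hc'),
    integral_uniformSphere_comp ((ℝ ∙ (x - y)).reflection)
      (fun s => ⟪gradEstimator μ f x s, x - y⟫_ℝ), integral_const_mul, integral_div,
    integral_uniformSphere_inner_sq hn] at h
  have e : ∀ K : ℝ, 2 * n * K * (‖x - y‖ ^ 2 / n / ‖x - y‖ ^ 2) = 2 * K := fun K => by
    field_simp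
  rw [e] at h
  linarith

theorem integral_norm_gradEstimator_sq_le (hf : IsSmoothConvex L f) (hL : 0 < L) {μ : ℝ}
    (hμ : 0 < μ) (hn : 0 < n) (x : EuclideanSpace ℝ (Fin n)) :
    ∫ s, ‖gradEstimator μ f x s‖ ^ 2 ∂uniformSphere n ≤
      2 * n * ‖gradient f x‖ ^ 2 + n ^ 2 * L ^ 2 * μ ^ 2 / 8 := by
  have := isProbabilityMeasure_uniformSphere hn
  have hn' : (n : ℝ) ≠ 0 := by positivity
  have hc : Continuous fun s => ‖gradEstimator μ f x s‖ ^ 2 :=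
    (((hf.continuous_gradEstimator μ).comp (Continuous.prodMk_right x)).norm).pow 2
  calc _ ≤ ∫ s, (2 * n ^ 2 * ⟪s, gradient f x⟫_ℝ ^ 2 + n ^ 2 * L ^ 2 * μ ^ 2 / 8)
        ∂uniformSphere n := by
        refine integral_mono_ae (integrable_uniformSphere_of_continuous hn hc)
          (integrable_uniformSphere_of_continuous hn (by fun_prop)) ?_
        filter_upwards [ae_uniformSphere_norm_eq_one] with s hs
        rw [real_inner_comm]
        exact hf.norm_gradEstimator_sq_le hL hμ x s hs
    _ = _ := by
        rw [integral_add (integrable_uniformSphere_of_continuous hn (by fun_prop))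
          (integrable_const _), integral_const_mul, integral_uniformSphere_inner_sq hn]
        simp
        field_simp

end IsSmoothConvex

end BanditOCO

/-! ### Euclidean projection onto a closed convex set. -/

namespace BanditOCO

variable {n : ℕ} {X : Set (EuclideanSpace ℝ (Fin n))}

theorem proj_spec (hXc : IsClosed X) (hX : X.Nonempty) (y : EuclideanSpace ℝ (Fin n)) :
    proj X y ∈ X ∧ ∀ q ∈ X, dist y (proj X y) ≤ dist y q := by
  have h : ∃ p ∈ X, ∀ q ∈ X, dist y p ≤ dist y q := by
    obtain ⟨p, hp, h⟩ := hXc.exists_infDist_eq_dist hX y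
    exact ⟨p, hp, fun q hq => h ▸ Metric.infDist_le_dist_of_mem hq⟩
  rw [proj, dif_pos h]
  exact h.choose_spec

theorem inner_sub_proj_le (hXc : IsClosed X) (hXv : Convex ℝ X) (y : EuclideanSpace ℝ (Fin n))
    {q : EuclideanSpace ℝ (Fin n)} (hq : q ∈ X) : ⟪y - proj X y, q - proj X y⟫_ℝ ≤ 0 := by
  obtain ⟨hp, hmin⟩ := proj_spec hXc ⟨q, hq⟩ y
  have : Nonempty X := ⟨⟨q, hq⟩⟩
  refine (norm_eq_iInf_iff_real_inner_le_zero hXv hp).1 (le_antisymm ?_ ?_) q hq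
  · exact le_ciInf fun w => by simpa [dist_eq_norm] using hmin w w.2
  · exact ciInf_le ⟨0, Set.forall_mem_range.2 fun w : X => norm_nonneg (y - (w : _))⟩
      (⟨proj X y, hp⟩ : X)

theorem norm_proj_sub_proj_le (hXc : IsClosed X) (hXv : Convex ℝ X) (hX : X.Nonempty)
    (y z : EuclideanSpace ℝ (Fin n)) : ‖proj X y - proj X z‖ ≤ ‖y - z‖ := by
  have h1 := inner_sub_proj_le hXc hXv y (proj_spec hXc hX z).1
  have h2 := inner_sub_proj_le hXc hXv z (proj_spec hXc hX y).1
  have h3 : ‖proj X y - proj X z‖ ^ 2 ≤ ⟪y - z, proj X y - proj X z⟫_ℝ := by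
    have e : ⟪y - z, proj X y - proj X z⟫_ℝ = ‖proj X y - proj X z‖ ^ 2
        - ⟪y - proj X y, proj X z - proj X y⟫_ℝ - ⟪z - proj X z, proj X y - proj X z⟫_ℝ := by
      rw [← real_inner_self_eq_norm_sq, ← neg_sub (proj X y) (proj X z), inner_neg_right,
        sub_neg_eq_add, ← inner_add_left, ← inner_sub_left]
      congr 1
      abel
    linarith
  have h4 := real_inner_le_norm (y - z) (proj X y - proj X z)
  nlinarith [norm_nonneg (proj X y - proj X z), norm_nonneg (y - z)]

theorem continuous_proj (hXc : IsClosed X) (hXv : Convex ℝ X) (hX : X.Nonempty) :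
    Continuous (proj X) := by
  refine (LipschitzWith.of_dist_le_mul (K := 1) fun y z => ?_).continuous
  simpa [dist_eq_norm] using norm_proj_sub_proj_le hXc hXv hX y z

theorem proj_eq_self (hXc : IsClosed X) {q : EuclideanSpace ℝ (Fin n)} (hq : q ∈ X) :
    proj X q = q := by
  have h := (proj_spec hXc ⟨q, hq⟩ q).2 q hq
  rw [dist_self] at h
  exact (dist_le_zero.1 h).symm

theorem norm_proj_sub_le (hXc : IsClosed X) (hXv : Convex ℝ X) (y : EuclideanSpace ℝ (Fin n))
    {q : EuclideanSpace ℝ (Fin n)} (hq : q ∈ X) : ‖proj X y - q‖ ≤ ‖y - q‖ := by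
  simpa [proj_eq_self hXc hq] using norm_proj_sub_proj_le hXc hXv ⟨q, hq⟩ y q

/-! ### Pathwise AdaGrad-Norm analysis. -/

variable {α μ : ℝ} {ℓ : ℕ → EuclideanSpace ℝ (Fin n) → ℝ} {x₁ : EuclideanSpace ℝ (Fin n)}
  {s : ℕ → EuclideanSpace ℝ (Fin n)}

theorem bgdIterate_mem (hXc : IsClosed X) (hx₁ : x₁ ∈ X) (t : ℕ) :
    bgdIterate X α μ ℓ x₁ s t ∈ X := by
  unfold bgdIterate
  induction t with
  | zero => exact hx₁
  | succ t ih =>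
    simp only [bgdState]
    split_ifs
    · exact ih
    · exact (proj_spec hXc ⟨x₁, hx₁⟩ _).1

theorem bgdState_snd (t : ℕ) :
    (bgdState X α μ ℓ x₁ s t).2 =
      ∑ i ∈ Finset.range t, ‖gradEstimator μ (ℓ i) (bgdIterate X α μ ℓ x₁ s i) (s i)‖ ^ 2 := by
  induction t with
  | zero => simp [bgdState]
  | succ t ih => rw [Finset.sum_range_succ, ← ih]; rfl

/-- Inductive step for the potential. Here `a`, `a'` are squared distances to the comparator and `D`
bounds `a`, so raising `√v` to `√(v + g)` only enlarges the distance term; the step's quadratic cost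
is at most `α * (√(v + g) - √v)` and telescopes. -/
theorem adagrad_step {v g a d D a' α : ℝ} {w : ℝ} (hα : 0 < α) (hv : 0 ≤ v) (hg : 0 < g)
    (ha : a ≤ D) (hstep : a' ≤ a - 2 * (α / √(v + g)) * d + (α / √(v + g)) ^ 2 * g)
    (hw : w ≤ √v * ((D - a) / (2 * α) + α)) :
    w + d ≤ √(v + g) * ((D - a') / (2 * α) + α) := by
  have hr0 : 0 ≤ √v := Real.sqrt_nonneg _
  have hr : 0 < √(v + g) := Real.sqrt_pos.2 (by linarith)
  have hrr : √v ≤ √(v + g) := Real.sqrt_le_sqrt (by linarith)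
  have h1 : √v ^ 2 = v := Real.sq_sqrt hv
  have h2 : √(v + g) ^ 2 = v + g := Real.sq_sqrt (by linarith)
  set r := √v
  set R := √(v + g)
  have hgR : g = R ^ 2 - r ^ 2 := by linarith
  have hd : d ≤ R * (a - a') / (2 * α) + α * g / (2 * R) := by
    have h3 : 2 * (α / R) * d ≤ a - a' + (α / R) ^ 2 * g := by linarith
    have h4 := mul_le_mul_of_nonneg_left h3 (by positivity : 0 ≤ R / (2 * α))
    refine (le_of_eq ?_).trans (h4.trans (le_of_eq ?_)) <;> field_simp
  have h5 : α * g / (2 * R) ≤ α * (R - r) := by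
    rw [div_le_iff₀ (by positivity), hgR]
    nlinarith [mul_nonneg hα.le (sq_nonneg (R - r))]
  have h6 : r * ((D - a) / (2 * α)) ≤ R * ((D - a) / (2 * α)) := by
    have : 0 ≤ (D - a) / (2 * α) := div_nonneg (by linarith) (by positivity)
    gcongr
  have h7 : R * ((D - a') / (2 * α) + α) =
      R * ((D - a) / (2 * α)) + R * (a - a') / (2 * α) + α * R := by
    field_simp
    ring
  rw [h7]
  linarith

theorem sum_inner_gradEstimator_le (hXc : IsClosed X) (hXv : Convex ℝ X) (hx₁ : x₁ ∈ X)
    (hα : 0 < α) {D : ℝ} {x : EuclideanSpace ℝ (Fin n)} (hx : x ∈ X)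
    (hD : ∀ p ∈ X, ‖p - x‖ ≤ D) (t : ℕ) :
    ∑ i ∈ Finset.range t, ⟪gradEstimator μ (ℓ i) (bgdIterate X α μ ℓ x₁ s i) (s i),
        bgdIterate X α μ ℓ x₁ s i - x⟫_ℝ ≤
      √(bgdState X α μ ℓ x₁ s t).2 *
        ((D ^ 2 - ‖bgdIterate X α μ ℓ x₁ s t - x‖ ^ 2) / (2 * α) + α) := by
  induction t with
  | zero => simp [bgdState]
  | succ t ih =>
    rw [Finset.sum_range_succ]
    set p := bgdIterate X α μ ℓ x₁ s t with hp
    set g := gradEstimator μ (ℓ t) p (s t) with hg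
    set v := (bgdState X α μ ℓ x₁ s t).2 with hv
    have hv' : (bgdState X α μ ℓ x₁ s (t + 1)).2 = v + ‖g‖ ^ 2 := rfl
    have hv0 : 0 ≤ v := by rw [hv, bgdState_snd]; positivity
    rw [hv']
    by_cases hg0 : g = 0
    · have hp' : bgdIterate X α μ ℓ x₁ s (t + 1) = p := if_pos hg0
      rw [hp', hg0]
      simpa using ih
    · have hp' : bgdIterate X α μ ℓ x₁ s (t + 1) =
          proj X (p - (α / √(v + ‖g‖ ^ 2)) • g) := if_neg hg0
      have hpD : ‖p - x‖ ^ 2 ≤ D ^ 2 := by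
        have := hD p (bgdIterate_mem hXc hx₁ t)
        gcongr
      refine adagrad_step hα hv0 (by have := norm_pos_iff.2 hg0; positivity) hpD ?_ ih
      rw [hp']
      calc _ ≤ ‖p - (α / √(v + ‖g‖ ^ 2)) • g - x‖ ^ 2 := by
            gcongr; exact norm_proj_sub_le hXc hXv _ hx
        _ = ‖(p - x) - (α / √(v + ‖g‖ ^ 2)) • g‖ ^ 2 := by rw [sub_right_comm]
        _ = _ := by
          rw [norm_sub_sq_real, norm_smul, mul_pow, Real.norm_eq_abs, sq_abs,
            real_inner_smul_right, real_inner_comm]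
          ring

theorem sum_inner_gradEstimator_le_sqrt (hXc : IsClosed X) (hXv : Convex ℝ X) (hx₁ : x₁ ∈ X)
    {D : ℝ} (hD0 : 0 < D) (hα : α = √2 * D / 2) {x : EuclideanSpace ℝ (Fin n)} (hx : x ∈ X)
    (hD : ∀ p ∈ X, ‖p - x‖ ≤ D) (t : ℕ) :
    ∑ i ∈ Finset.range t, ⟪gradEstimator μ (ℓ i) (bgdIterate X α μ ℓ x₁ s i) (s i),
        bgdIterate X α μ ℓ x₁ s i - x⟫_ℝ ≤
      √2 * D * √(bgdState X α μ ℓ x₁ s t).2 := by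
  have hα0 : 0 < α := by rw [hα]; positivity
  refine (sum_inner_gradEstimator_le hXc hXv hx₁ hα0 hx hD t).trans ?_
  rw [mul_comm (√2 * D)]
  gcongr
  calc _ ≤ D ^ 2 / (2 * α) + α := by
        gcongr
        linarith [sq_nonneg ‖bgdIterate X α μ ℓ x₁ s t - x‖]
    -- The chosen `α` minimizes `D ^ 2 / (2 * α) + α`.
    _ = √2 * D := by
        rw [hα]
        field_simp
        nlinarith [Real.sq_sqrt (show (0 : ℝ) ≤ 2 by norm_num)]

/-! ### Causality and measurability of the iterates. -/

theorem bgdState_congr {s' : ℕ → EuclideanSpace ℝ (Fin n)} {t : ℕ} (h : ∀ i < t, s i = s' i) :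
    bgdState X α μ ℓ x₁ s t = bgdState X α μ ℓ x₁ s' t := by
  induction t with
  | zero => rfl
  | succ t ih =>
    simp only [bgdState, ih fun i hi => h i (hi.trans t.lt_succ_self), h t t.lt_succ_self]

theorem measurable_bgdState (hXc : IsClosed X) (hXv : Convex ℝ X) (hx₁ : x₁ ∈ X) {T : ℕ}
    (hℓ : ∀ t < T, Continuous (ℓ t)) {t : ℕ} (ht : t ≤ T) :
    Measurable fun s : ℕ → EuclideanSpace ℝ (Fin n) => bgdState X α μ ℓ x₁ s t := by
  induction t with
  | zero => exact measurable_const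
  | succ t ih =>
    have ih := ih (Nat.le_of_succ_le ht)
    have hℓt := (hℓ t ht).measurable
    have hproj := (continuous_proj hXc hXv ⟨x₁, hx₁⟩).measurable
    have hx := ih.fst
    have hv := ih.snd
    have hs : Measurable fun s : ℕ → EuclideanSpace ℝ (Fin n) => s t := measurable_pi_apply t
    have hg : Measurable fun s : ℕ → EuclideanSpace ℝ (Fin n) =>
        gradEstimator μ (ℓ t) (bgdState X α μ ℓ x₁ s t).1 (s t) := by
      unfold gradEstimator
      exact (((hℓt.comp (hx.add (hs.const_smul μ))).sub
        (hℓt.comp (hx.sub (hs.const_smul μ)))).const_mul _).smul hs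
    have hv' := hv.add (hg.norm.pow_const 2)
    simp only [bgdState]
    refine Measurable.prodMk (Measurable.ite (hg (measurableSet_singleton 0)) hx ?_) hv'
    exact hproj.comp (hx.sub ((measurable_const.div hv'.sqrt).smul hg))

end BanditOCO

/-! ### Solving the recursive inequality, and Jensen for the square root. -/

namespace BanditOCO

theorem regret_bound_of_recursive_bound {a S G L D N : ℝ} (hL : 0 < L) (hD : 0 < D) (hN : 0 ≤ N)
    (hS : 0 ≤ S)
    (h : a + S / (4 * L) ≤
      √2 * D * √(4 * N * S + 4 * N * G + L ^ 2 * D ^ 2 / 8) + 5 / 2 * L * D ^ 2) :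
    a ≤ max (16 * L * D ^ 2 * N) (4 * D * √(N * G)) + 5 * L * D ^ 2 := by
  -- Used with `M` the larger of `S` and `G`; the two cases produce the two entries of the maximum.
  have key : ∀ M : ℝ, S ≤ M → G ≤ M →
      √2 * D * √(4 * N * S + 4 * N * G + L ^ 2 * D ^ 2 / 8) ≤
        4 * D * √(N * M) + L * D ^ 2 / 2 := by
    intro M hSM hGM
    have hM : 0 ≤ M := hS.trans hSM
    have hle : √2 * √(4 * N * S + 4 * N * G + L ^ 2 * D ^ 2 / 8) ≤ 4 * √(N * M) + L * D / 2 := by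
      rw [← Real.sqrt_mul (by norm_num)]
      refine Real.sqrt_le_iff.2 ⟨by positivity, ?_⟩
      have hsq : √(N * M) ^ 2 = N * M := Real.sq_sqrt (by positivity)
      have h1 : N * S ≤ N * M := by gcongr
      have h2 : N * G ≤ N * M := by gcongr
      have h3 : 0 ≤ √(N * M) * (L * D) := by positivity
      nlinarith
    calc _ = D * (√2 * √(4 * N * S + 4 * N * G + L ^ 2 * D ^ 2 / 8)) := by ring
      _ ≤ D * (4 * √(N * M) + L * D / 2) := by gcongr
      _ = _ := by ring
  have hLD : 0 ≤ L * D ^ 2 := by positivity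
  rcases le_total S G with hSG | hGS
  · have h1 := key G hSG le_rfl
    have h2 := le_max_right (16 * L * D ^ 2 * N) (4 * D * √(N * G))
    have h3 : 0 ≤ S / (4 * L) := by positivity
    linarith
  · have h1 := key S le_rfl hGS
    have h2 := le_max_left (16 * L * D ^ 2 * N) (4 * D * √(N * G))
    have h3 : 4 * D * √(N * S) ≤ 16 * L * D ^ 2 * N + S / (4 * L) := by
      rw [Real.sqrt_mul hN]
      have hN2 : √N ^ 2 = N := Real.sq_sqrt hN
      have hS2 : √S ^ 2 = S := Real.sq_sqrt hS
      -- Young's inequality, weighted so that the `S` term is exactly the available gain `S / (4 *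
      -- L)`.
      have h4 : 0 ≤ (8 * L * D * √N - √S) ^ 2 / (4 * L) := by positivity
      have h5 : (8 * L * D * √N - √S) ^ 2 / (4 * L) =
          16 * L * D ^ 2 * √N ^ 2 + √S ^ 2 / (4 * L) - 4 * D * (√N * √S) := by
        field_simp
        ring
      rw [hN2, hS2] at h5
      linarith
    linarith

theorem integrable_sqrt {Ω : Type*} [MeasurableSpace Ω] {P : Measure Ω}
    [IsProbabilityMeasure P] {V : Ω → ℝ} (h0 : ∀ ω, 0 ≤ V ω) (hV : Integrable V P) :
    Integrable (fun ω => √(V ω)) P := by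
  refine ((integrable_const 1).add hV).mono'
    (Real.continuous_sqrt.comp_aestronglyMeasurable hV.aestronglyMeasurable)
    (Filter.Eventually.of_forall fun ω => ?_)
  rw [Real.norm_of_nonneg (Real.sqrt_nonneg _), Pi.add_apply]
  exact Real.sqrt_le_iff.2 ⟨by linarith [h0 ω], by nlinarith [h0 ω]⟩

theorem integral_sqrt_le_sqrt_integral {Ω : Type*} [MeasurableSpace Ω] {P : Measure Ω}
    [IsProbabilityMeasure P] {V : Ω → ℝ} (h0 : ∀ ω, 0 ≤ V ω) (hV : Integrable V P) :
    ∫ ω, √(V ω) ∂P ≤ √(∫ ω, V ω ∂P) := by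
  exact Real.strictConcaveOn_sqrt.concaveOn.le_map_integral Real.continuous_sqrt.continuousOn
    isClosed_Ici (Filter.Eventually.of_forall h0) hV (integrable_sqrt h0 hV)

/-! ### Moments at a random point independent of the direction. -/

section Probability

variable {Ω : Type*} [MeasurableSpace Ω] {P : Measure Ω} [IsProbabilityMeasure P] {n : ℕ}
  {X : Set (EuclideanSpace ℝ (Fin n))}

theorem integrable_comp_of_isBounded {F : Type*} [NormedAddCommGroup F] (hX : Bornology.IsBounded X)
    {p : Ω → EuclideanSpace ℝ (Fin n)} (hp : AEMeasurable p P) (hpX : ∀ ω, p ω ∈ X)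
    {h : EuclideanSpace ℝ (Fin n) → F} (hh : Continuous h) : Integrable (fun ω => h (p ω)) P := by
  obtain ⟨C, hC⟩ := hX.isCompact_closure.exists_bound_of_continuousOn hh.continuousOn
  exact Integrable.of_bound (hh.comp_aestronglyMeasurable hp.aestronglyMeasurable) C
    (Filter.Eventually.of_forall fun ω => hC _ (subset_closure (hpX ω)))

theorem integrable_comp_prodMk (hX : Bornology.IsBounded X)
    {p u : Ω → EuclideanSpace ℝ (Fin n)} (hp : AEMeasurable p P) (hpX : ∀ ω, p ω ∈ X)
    (hu : HasLaw u (uniformSphere n) P)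
    {F : EuclideanSpace ℝ (Fin n) × EuclideanSpace ℝ (Fin n) → ℝ} (hF : Continuous F) :
    Integrable (fun ω => F (p ω, u ω)) P := by
  obtain ⟨C, hC⟩ := (hX.isCompact_closure.prod
    (isCompact_sphere (0 : EuclideanSpace ℝ (Fin n)) 1)).exists_bound_of_continuousOn hF.continuousOn
  refine Integrable.of_bound (hF.comp_aestronglyMeasurable
    (hp.prodMk hu.aemeasurable).aestronglyMeasurable) C ?_
  have hu1 : ∀ᵐ ω ∂P, ‖u ω‖ = 1 := by
    have := ae_uniformSphere_norm_eq_one (n := n)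
    rw [← hu.map_eq] at this
    exact ae_of_ae_map hu.aemeasurable this
  filter_upwards [hu1] with ω hω
  exact hC _ ⟨subset_closure (hpX ω), by simpa using hω⟩

/-- Fubini on the product law replaces conditioning on the past; integrability holds because `F` is
bounded on a compact set carrying the law. -/
theorem integrable_and_integral_comp_prodMk (hn : 0 < n) (hX : Bornology.IsBounded X)
    {p u : Ω → EuclideanSpace ℝ (Fin n)} (hp : AEMeasurable p P) (hpX : ∀ ω, p ω ∈ X)
    (hu : HasLaw u (uniformSphere n) P) (hpu : IndepFun p u P)
    {F : EuclideanSpace ℝ (Fin n) × EuclideanSpace ℝ (Fin n) → ℝ} (hF : Continuous F) :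
    Integrable (fun ω => ∫ v, F (p ω, v) ∂uniformSphere n) P ∧
    ∫ ω, F (p ω, u ω) ∂P = ∫ ω, ∫ v, F (p ω, v) ∂uniformSphere n ∂P := by
  have := isProbabilityMeasure_uniformSphere hn
  have := Measure.isProbabilityMeasure_map hp
  have hpu' := (indepFun_iff_map_prod_eq_prod_map_map hp hu.aemeasurable).1 hpu
  rw [hu.map_eq] at hpu'
  have hint : Integrable F ((P.map p).prod (uniformSphere n)) := by
    rw [← hpu']
    exact (integrable_map_measure hF.aestronglyMeasurable (hp.prodMk hu.aemeasurable)).2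
      (integrable_comp_prodMk hX hp hpX hu hF)
  refine ⟨(integrable_map_measure hint.integral_prod_left.aestronglyMeasurable hp).1
    hint.integral_prod_left, ?_⟩
  rw [← integral_map (hp.prodMk hu.aemeasurable) hF.aestronglyMeasurable, hpu',
    integral_prod _ hint, integral_map hp hint.integral_prod_left.aestronglyMeasurable]

variable {L : ℝ} {f : EuclideanSpace ℝ (Fin n) → ℝ}
  {p u : Ω → EuclideanSpace ℝ (Fin n)} {μ : ℝ}

theorem integral_gap_add_le_integral_inner_gradEstimator (hn : 0 < n)
    (hX : Bornology.IsBounded X) (hp : AEMeasurable p P) (hpX : ∀ ω, p ω ∈ X)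
    (hu : HasLaw u (uniformSphere n) P) (hpu : IndepFun p u P) (hf : IsSmoothConvex L f)
    (hL : 0 < L) (hμ : 0 < μ) (x : EuclideanSpace ℝ (Fin n)) :
    ∫ ω, (f (p ω) - f x) ∂P + (∫ ω, ‖gradient f (p ω) - gradient f x‖ ^ 2 ∂P) / (4 * L)
      - 5 / 2 * L * μ ^ 2 ≤ ∫ ω, ⟪gradEstimator μ f (p ω) (u ω), p ω - x⟫_ℝ ∂P := by
  have hF : Continuous fun q : EuclideanSpace ℝ (Fin n) × EuclideanSpace ℝ (Fin n) =>
      ⟪gradEstimator μ f q.1 q.2, q.1 - x⟫_ℝ :=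
    (hf.continuous_gradEstimator μ).inner (by fun_prop)
  obtain ⟨h1, h2⟩ := integrable_and_integral_comp_prodMk hn hX hp hpX hu hpu hF
  have hfc := hf.continuous
  have hgc := hf.continuous_gradient hL
  have i1 : Integrable (fun ω => f (p ω) - f x) P :=
    integrable_comp_of_isBounded hX hp hpX (h := fun q => f q - f x) (by fun_prop)
  have i2 : Integrable (fun ω => ‖gradient f (p ω) - gradient f x‖ ^ 2) P :=
    integrable_comp_of_isBounded hX hp hpX (h := fun q => ‖gradient f q - gradient f x‖ ^ 2)
      (by fun_prop)
  have i3 : Integrable (fun ω => f (p ω) - f x +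
      ‖gradient f (p ω) - gradient f x‖ ^ 2 / (4 * L)) P := i1.add (i2.div_const (4 * L))
  calc _ = ∫ ω, (f (p ω) - f x + ‖gradient f (p ω) - gradient f x‖ ^ 2 / (4 * L)
        - 5 / 2 * L * μ ^ 2) ∂P := by
        rw [integral_sub i3 (integrable_const _), integral_add i1 (i2.div_const _), integral_div]
        simp
    _ ≤ ∫ ω, ∫ v, ⟪gradEstimator μ f (p ω) v, p ω - x⟫_ℝ ∂uniformSphere n ∂P :=
        integral_mono (i3.sub (integrable_const _)) h1
          fun ω => hf.integral_inner_gradEstimator_ge hL hμ hn (p ω) x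
    _ = _ := h2.symm

theorem integral_norm_gradEstimator_comp_sq_le (hn : 0 < n)
    (hX : Bornology.IsBounded X) (hp : AEMeasurable p P) (hpX : ∀ ω, p ω ∈ X)
    (hu : HasLaw u (uniformSphere n) P) (hpu : IndepFun p u P) (hf : IsSmoothConvex L f)
    (hL : 0 < L) (hμ : 0 < μ) (x : EuclideanSpace ℝ (Fin n)) :
    ∫ ω, ‖gradEstimator μ f (p ω) (u ω)‖ ^ 2 ∂P ≤
      4 * n * ∫ ω, ‖gradient f (p ω) - gradient f x‖ ^ 2 ∂P + 4 * n * ‖gradient f x‖ ^ 2 +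
        n ^ 2 * L ^ 2 * μ ^ 2 / 8 := by
  have hF : Continuous fun q : EuclideanSpace ℝ (Fin n) × EuclideanSpace ℝ (Fin n) =>
      ‖gradEstimator μ f q.1 q.2‖ ^ 2 := (hf.continuous_gradEstimator μ).norm.pow 2
  obtain ⟨h1, h2⟩ := integrable_and_integral_comp_prodMk hn hX hp hpX hu hpu hF
  have hgc := hf.continuous_gradient hL
  have i2 : Integrable (fun ω => ‖gradient f (p ω) - gradient f x‖ ^ 2) P :=
    integrable_comp_of_isBounded hX hp hpX (h := fun q => ‖gradient f q - gradient f x‖ ^ 2)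
      (by fun_prop)
  have i3 : Integrable (fun ω => 4 * n * ‖gradient f (p ω) - gradient f x‖ ^ 2 +
      4 * n * ‖gradient f x‖ ^ 2) P := (i2.const_mul (4 * n)).add (integrable_const _)
  calc _ = ∫ ω, ∫ v, ‖gradEstimator μ f (p ω) v‖ ^ 2 ∂uniformSphere n ∂P := h2
    _ ≤ ∫ ω, (4 * n * ‖gradient f (p ω) - gradient f x‖ ^ 2 + 4 * n * ‖gradient f x‖ ^ 2 +
          n ^ 2 * L ^ 2 * μ ^ 2 / 8) ∂P := by
        refine integral_mono h1 (i3.add (integrable_const _)) fun ω => ?_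
        refine (hf.integral_norm_gradEstimator_sq_le hL hμ hn (p ω)).trans ?_
        have ht := norm_add_le (gradient f (p ω) - gradient f x) (gradient f x)
        rw [sub_add_cancel] at ht
        have ht2 : ‖gradient f (p ω)‖ ^ 2 ≤
            2 * ‖gradient f (p ω) - gradient f x‖ ^ 2 + 2 * ‖gradient f x‖ ^ 2 := by
          calc _ ≤ (‖gradient f (p ω) - gradient f x‖ + ‖gradient f x‖) ^ 2 := by gcongr
            _ ≤ _ := by
              nlinarith [sq_nonneg (‖gradient f (p ω) - gradient f x‖ - ‖gradient f x‖)]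
        have ht3 := mul_le_mul_of_nonneg_left ht2 (by positivity : (0 : ℝ) ≤ 2 * n)
        linarith
    _ = _ := by
        rw [integral_add i3 (integrable_const _), integral_add (i2.const_mul _)
          (integrable_const _), integral_const_mul]
        simp

variable {ℓ : ℕ → EuclideanSpace ℝ (Fin n) → ℝ} {x₁ : EuclideanSpace ℝ (Fin n)} {α : ℝ}
  {s : ℕ → Ω → EuclideanSpace ℝ (Fin n)} {T : ℕ}

omit [IsProbabilityMeasure P] in
theorem aemeasurable_bgdIterate (hXc : IsClosed X) (hXv : Convex ℝ X) (hx₁ : x₁ ∈ X)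
    (hℓ : ∀ t < T, Continuous (ℓ t)) (hs : ∀ t, AEMeasurable (s t) P) {t : ℕ} (ht : t ≤ T) :
    AEMeasurable (fun ω => bgdIterate X α μ ℓ x₁ (fun i => s i ω) t) P :=
  (measurable_bgdState hXc hXv hx₁ hℓ ht).fst.comp_aemeasurable (aemeasurable_pi_lambda _ hs)

omit [IsProbabilityMeasure P] in
theorem indepFun_bgdIterate (hXc : IsClosed X) (hXv : Convex ℝ X) (hx₁ : x₁ ∈ X)
    (hℓ : ∀ t < T, Continuous (ℓ t)) (hs : ∀ t, AEMeasurable (s t) P) (hind : iIndepFun s P)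
    {t : ℕ} (ht : t ≤ T) :
    IndepFun (fun ω => bgdIterate X α μ ℓ x₁ (fun i => s i ω) t) (s t) P := by
  have h := hind.indepFun_finset₀ (Finset.range t) {t} (by simp) hs
  -- The iterate before round `t` ignores directions from `t` on, so padding the past with zeros
  -- exhibits it as a function of the past alone.
  have hext : Measurable fun (y : Finset.range t → EuclideanSpace ℝ (Fin n)) (i : ℕ) =>
      if hi : i ∈ Finset.range t then y ⟨i, hi⟩ else 0 := by
    refine measurable_pi_lambda _ fun i => ?_
    split_ifs
    · exact measurable_pi_apply _
    · exact measurable_const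
  have h' := h.comp ((measurable_bgdState (α := α) (μ := μ) hXc hXv hx₁ hℓ ht).fst.comp hext)
    (measurable_pi_apply (⟨t, Finset.mem_singleton_self t⟩ : ({t} : Finset ℕ)))
  convert h' using 1
  · ext1 ω
    simp only [bgdIterate, Function.comp]
    rw [bgdState_congr]
    intro i hi
    simp [hi]
  · rfl

end Probability

end BanditOCO

/-! ### Assembly of the regret bound. -/

open BanditOCO in
theorem mainTheorem9 {Ω : Type*} [MeasurableSpace Ω] (P : Measure Ω) [IsProbabilityMeasure P]
    (n : ℕ) (hn : 8 ≤ n) (T : ℕ) (hT : 1 ≤ T) (L D : ℝ) (hL : 0 < L) (hD : 0 < D)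
    (X : Set (EuclideanSpace ℝ (Fin n))) (hXclosed : IsClosed X) (hXconvex : Convex ℝ X)
    (hXbdd : Bornology.IsBounded X) (hXdiam : Metric.diam X ≤ D)
    (ℓ : ℕ → EuclideanSpace ℝ (Fin n) → ℝ)
    (hℓ : ∀ t < T, BanditOCO.IsSmoothConvex L (ℓ t))
    (x₁ : EuclideanSpace ℝ (Fin n)) (hx₁ : x₁ ∈ X)
    (s : ℕ → Ω → EuclideanSpace ℝ (Fin n))
    (hs_law : ∀ t, HasLaw (s t) (BanditOCO.uniformSphere n) P)
    (hs_indep : iIndepFun s P)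
    (α μ : ℝ) (hα : α = √2 * D / 2) (hμ : μ = D / (n * √T))
    (x : EuclideanSpace ℝ (Fin n)) (hx : x ∈ X) :
    Integrable (fun ω => BanditOCO.regret ℓ
      (BanditOCO.bgdIterate X α μ ℓ x₁ (fun t => s t ω)) T x) P ∧
    ∫ ω, BanditOCO.regret ℓ
      (BanditOCO.bgdIterate X α μ ℓ x₁ (fun t => s t ω)) T x ∂P
      ≤ max (16 * L * D ^ 2 * n) (4 * D * √(n * BanditOCO.cumNonstationarity ℓ T x))
        + 5 * L * D ^ 2 := by
  have hn0 : 0 < n := by omega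
  have hT0 : (0 : ℝ) < T := by exact_mod_cast hT
  have hμ0 : 0 < μ := by rw [hμ]; positivity
  -- The choice of `μ` makes the accumulated second-moment error exactly `L ^ 2 * D ^ 2 / 8`.
  have hTμ : T * (n ^ 2 * μ ^ 2) = D ^ 2 := by
    have := Real.sq_sqrt hT0.le
    rw [hμ, div_pow, mul_pow, this]
    field_simp
  have hTμ' : T * μ ^ 2 ≤ D ^ 2 := by
    rw [← hTμ]
    have : (1 : ℝ) ≤ n ^ 2 := one_le_pow₀ (by exact_mod_cast hn0)
    have h0 : 0 ≤ μ ^ 2 := by positivity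
    gcongr
    nlinarith
  have hℓc : ∀ t < T, Continuous (ℓ t) := fun t ht => (hℓ t ht).continuous
  have hsm : ∀ t, AEMeasurable (s t) P := fun t => (hs_law t).aemeasurable
  set p : ℕ → Ω → EuclideanSpace ℝ (Fin n) :=
    fun t ω => bgdIterate X α μ ℓ x₁ (fun i => s i ω) t with hp
  have hpm : ∀ t < T, AEMeasurable (p t) P := fun t ht =>
    aemeasurable_bgdIterate hXclosed hXconvex hx₁ hℓc hsm ht.le
  have hpX : ∀ t ω, p t ω ∈ X := fun t ω => bgdIterate_mem hXclosed hx₁ t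
  have hind : ∀ t < T, IndepFun (p t) (s t) P := fun t ht =>
    indepFun_bgdIterate hXclosed hXconvex hx₁ hℓc hsm hs_indep ht.le
  have hgap : ∀ t ∈ Finset.range T, Integrable (fun ω => ℓ t (p t ω) - ℓ t x) P := fun t ht => by
    have ht := Finset.mem_range.1 ht
    exact integrable_comp_of_isBounded hXbdd (hpm t ht) (hpX t) (h := fun q => ℓ t q - ℓ t x)
      ((hℓc t ht).sub continuous_const)
  have hinner : ∀ t ∈ Finset.range T,
      Integrable (fun ω => ⟪gradEstimator μ (ℓ t) (p t ω) (s t ω), p t ω - x⟫_ℝ) P :=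
    fun t ht => by
      have ht := Finset.mem_range.1 ht
      exact integrable_comp_prodMk hXbdd (hpm t ht) (hpX t) (hs_law t)
        (F := fun q => ⟪gradEstimator μ (ℓ t) q.1 q.2, q.1 - x⟫_ℝ)
        (((hℓ t ht).continuous_gradEstimator μ).inner (by fun_prop))
  have hsq : ∀ t ∈ Finset.range T,
      Integrable (fun ω => ‖gradEstimator μ (ℓ t) (p t ω) (s t ω)‖ ^ 2) P := fun t ht => by
    have ht := Finset.mem_range.1 ht
    exact integrable_comp_prodMk hXbdd (hpm t ht) (hpX t) (hs_law t)
      (F := fun q => ‖gradEstimator μ (ℓ t) q.1 q.2‖ ^ 2)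
      (((hℓ t ht).continuous_gradEstimator μ).norm.pow 2)
  have hsum := integrable_finsetSum _ hgap
  refine ⟨hsum, ?_⟩
  set S : ℝ := ∑ t ∈ Finset.range T, ∫ ω, ‖gradient (ℓ t) (p t ω) - gradient (ℓ t) x‖ ^ 2 ∂P
    with hS
  have hS0 : 0 ≤ S := Finset.sum_nonneg fun t _ => integral_nonneg fun ω => by positivity
  set V : Ω → ℝ := fun ω => ∑ t ∈ Finset.range T, ‖gradEstimator μ (ℓ t) (p t ω) (s t ω)‖ ^ 2
    with hV
  have hV0 : ∀ ω, 0 ≤ V ω := fun ω => Finset.sum_nonneg fun t _ => by positivity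
  have hVint : Integrable V P := integrable_finsetSum _ hsq
  have hVle : ∫ ω, V ω ∂P ≤
      4 * n * S + 4 * n * cumNonstationarity ℓ T x + L ^ 2 * D ^ 2 / 8 := by
    rw [integral_finsetSum _ hsq]
    refine (Finset.sum_le_sum fun t ht => integral_norm_gradEstimator_comp_sq_le hn0 hXbdd
      (hpm t (Finset.mem_range.1 ht)) (hpX t) (hs_law t) (hind t (Finset.mem_range.1 ht))
      (hℓ t (Finset.mem_range.1 ht)) hL hμ0 x).trans (le_of_eq ?_)
    rw [Finset.sum_add_distrib, Finset.sum_add_distrib, ← Finset.mul_sum, ← Finset.mul_sum,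
      Finset.sum_const, Finset.card_range, nsmul_eq_mul, ← hTμ, cumNonstationarity]
    ring
  have hsub : ∫ ω, ∑ t ∈ Finset.range T, (ℓ t (p t ω) - ℓ t x) ∂P + S / (4 * L)
      - T * (5 / 2 * L * μ ^ 2) ≤
      ∫ ω, ∑ t ∈ Finset.range T, ⟪gradEstimator μ (ℓ t) (p t ω) (s t ω), p t ω - x⟫_ℝ ∂P := by
    rw [integral_finsetSum _ hgap, integral_finsetSum _ hinner]
    refine (le_of_eq ?_).trans (Finset.sum_le_sum fun t ht =>
      integral_gap_add_le_integral_inner_gradEstimator hn0 hXbdd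
      (hpm t (Finset.mem_range.1 ht)) (hpX t) (hs_law t) (hind t (Finset.mem_range.1 ht))
      (hℓ t (Finset.mem_range.1 ht)) hL hμ0 x)
    rw [Finset.sum_sub_distrib, Finset.sum_add_distrib, ← Finset.sum_div,
      Finset.sum_const, Finset.card_range, nsmul_eq_mul]
  have hada : ∫ ω, ∑ t ∈ Finset.range T,
      ⟪gradEstimator μ (ℓ t) (p t ω) (s t ω), p t ω - x⟫_ℝ ∂P ≤ √2 * D * ∫ ω, √(V ω) ∂P := by
    rw [← integral_const_mul]
    refine integral_mono (integrable_finsetSum _ hinner) ((integrable_sqrt hV0 hVint).const_mul _) fun ω => ?_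
    have h := sum_inner_gradEstimator_le_sqrt (μ := μ) (ℓ := ℓ) (s := fun i => s i ω)
      hXclosed hXconvex hx₁ hD hα hx (fun q hq => by
        rw [← dist_eq_norm]
        exact (Metric.dist_le_diam_of_mem hXbdd hq hx).trans hXdiam) T
    rw [bgdState_snd] at h
    exact h
  have hjensen : √2 * D * ∫ ω, √(V ω) ∂P ≤
      √2 * D * √(4 * n * S + 4 * n * cumNonstationarity ℓ T x + L ^ 2 * D ^ 2 / 8) := by
    gcongr
    exact (integral_sqrt_le_sqrt_integral hV0 hVint).trans (Real.sqrt_le_sqrt hVle)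
  refine regret_bound_of_recursive_bound hL hD (Nat.cast_nonneg n) hS0 ?_
  have hμL : T * (5 / 2 * L * μ ^ 2) ≤ 5 / 2 * L * D ^ 2 := by
    calc _ = 5 / 2 * L * (T * μ ^ 2) := by ring
      _ ≤ _ := by gcongr
  have hreg : (∫ ω, regret ℓ (bgdIterate X α μ ℓ x₁ (fun t => s t ω)) T x ∂P) =
      ∫ ω, ∑ t ∈ Finset.range T, (ℓ t (p t ω) - ℓ t x) ∂P := rfl
  rw [hreg]
  linarith
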